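/- Let $V, W \subset \mathbb{R}^2$ be closed bounded simply connected domains, that is, compact sets that are the closures of their interiors and whose interiors $\mathring V$, $\mathring W$ are (nonempty, connected and) simply connected. Let $F = (u,v) : V \to W$ be a harmonic map, i.e. $\Delta u = \Delta v = 0$ in $\mathring V$, with $F \in C^1(\mathring V) \cap C^0(V)$. Suppose that $F|_{\partial V}$ is an orientation-preserving homeomorphism of $\partial V$ onto $\partial W$ (orientation-preserving means: every closed curve in $\partial V$ that winds $n$ times counterclockwise around the points of $\mathring V$ is carried by $F$ to a closed curve that winds $n$ times counterclockwise around the points of $\mathring W$), and that the Jacobian determinant of $F$ does not vanish at any point of $\mathring V$. Then $F$ is injective on $V$. -/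

import Mathlib

open Set

/-- The Euclidean plane `ℝ²`. -/
abbrev Plane : Type := EuclideanSpace ℝ (Fin 2)

/-- A (closed, bounded) simply connected domain of the plane: a compact set which is the closure of
its interior and whose interior is a simply connected (in particular nonempty and connected)
open set. -/
structure IsClosedSimplyConnectedDomain (V : Set Plane) : Prop where
  isCompact : IsCompact V
  closure_interior : closure (interior V) = V
  isSimplyConnected_interior : IsSimplyConnected (interior V)

/-- `F = (u, v)` is a harmonic map on `V`: both of its components are harmonic functions in the
interior of `V`. -/
def IsHarmonicMap (F : Plane → Plane) (V : Set Plane) : Prop :=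
  ∀ i : Fin 2, InnerProductSpace.HarmonicOnNhd (fun x : Plane => F x i) (interior V)

/-- `γ`, restricted to `[0, 1]`, is a closed curve (a loop) with values in `S`. -/
def IsLoopIn (γ : ℝ → Plane) (S : Set Plane) : Prop :=
  ContinuousOn γ (Icc 0 1) ∧ γ 0 = γ 1 ∧ MapsTo γ (Icc 0 1) S

/-- The loop `γ : [0, 1] → ℝ²` avoids the point `p` and winds `n` times counterclockwise around it:
in polar coordinates `(r, θ)` centred at `p`, with a continuous choice of the angle `θ`, the total
change of the angle is `2πn`. -/
def HasWindingNumber (γ : ℝ → Plane) (p : Plane) (n : ℤ) : Prop :=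
  ∃ r θ : ℝ → ℝ, ContinuousOn r (Icc 0 1) ∧ ContinuousOn θ (Icc 0 1) ∧
    (∀ t ∈ Icc (0 : ℝ) 1,
      0 < r t ∧ γ t = p + r t • (!₂[Real.cos (θ t), Real.sin (θ t)] : Plane)) ∧
    θ 1 - θ 0 = 2 * Real.pi * n

/-- `F` restricts to a homeomorphism of `A` onto `B`. -/
def RestrictsToHomeomorph (F : Plane → Plane) (A B : Set Plane) : Prop :=
  ∃ e : A ≃ₜ B, ∀ x : A, (e x : Plane) = F x

/-- The boundary map `F|_{∂V} : ∂V → ∂W` preserves the orientation: a loop in `∂V` which winds `n`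
times counterclockwise around the interior points of `V` is carried to a loop in `∂W` which winds
`n` times counterclockwise around the interior points of `W`. -/
def PreservesBoundaryOrientation (F : Plane → Plane) (V W : Set Plane) : Prop :=
  ∀ γ : ℝ → Plane, IsLoopIn γ (frontier V) →
    ∀ z ∈ interior V, ∀ w ∈ interior W, ∀ n : ℤ,
      HasWindingNumber γ z n → HasWindingNumber (fun t => F (γ t)) w n

open Topology

/-! By the inverse function theorem `F` is a local homeomorphism, hence open, on `interior V`, and
so maps it into `interior W`. As `V` is compact and `frontier V` goes to `frontier W`, this map of
interiors is proper, hence a covering; its base is simply connected and its source connected, so it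
is injective. The frontier is injective by assumption, and its image misses `interior W`. -/

/-- A proper local homeomorphism between Hausdorff spaces is a covering map. -/
theorem IsLocalHomeomorph.isCoveringMap_of_isProperMap {E X : Type*} [TopologicalSpace E]
    [TopologicalSpace X] [T2Space E] [T1Space X] {f : E → X} (hf : IsLocalHomeomorph f)
    (hp : IsProperMap f) : IsCoveringMap f := by
  rw [isCoveringMap_iff_isCoveringMapOn_univ]
  refine hp.isClosedMap.isCoveringMapOn_of_isLocalHomeomorphOn (fun x _ => ?_)
    hf.isLocalHomeomorphOn
  refine (hp.isCompact_preimage isCompact_singleton).finite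
    (.of_openPartialHomeomorph f (x := x) subset_rfl fun e _ => ?_)
  obtain ⟨φ, hφ, rfl⟩ := hf e
  exact ⟨φ, hφ, rfl⟩

/-- A covering map from a connected space to a simply connected, locally path connected space is
injective. -/
theorem IsCoveringMap.injective_of_simplyConnectedSpace {E X : Type*} [TopologicalSpace E]
    [TopologicalSpace X] [PreconnectedSpace E] [SimplyConnectedSpace X]
    [LocallyPathConnectedSpace X] {f : E → X} (hf : IsCoveringMap f) : Function.Injective f := by
  intro x y hxy
  -- Lift the identity to a section `s` through `x`. Both `s ∘ f` and `id` lift `f` and agree at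
  -- `x`, so `s` is also a left inverse of `f`.
  obtain ⟨s, ⟨hsx, hs⟩, -⟩ :=
    hf.existsUnique_continuousMap_lifts (ContinuousMap.id X) (f x) x rfl
  have hsf : s ∘ f = id := by
    refine hf.eq_of_comp_eq (s.continuous.comp hf.continuous) continuous_id ?_ x hsx
    rw [← Function.comp_assoc, hs]
    rfl
  rw [← id_eq x, ← hsf, Function.comp_apply, hxy, ← Function.comp_apply (f := s), hsf, id_eq]

/-- The inverse function theorem for a `C¹` map with nonvanishing Jacobian on an open set. -/
theorem ContDiffOn.isLocalHomeomorphOn_of_det_fderiv_ne_zero {E : Type*} [NormedAddCommGroup E]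
    [NormedSpace ℝ E] [FiniteDimensional ℝ E] {F : E → E} {U : Set E} (hU : IsOpen U)
    (hF : ContDiffOn ℝ 1 F U) (hdet : ∀ x ∈ U, (fderiv ℝ F x).det ≠ 0) :
    IsLocalHomeomorphOn F U := by
  have : CompleteSpace E := FiniteDimensional.complete ℝ E
  intro x hx
  have hc : ContDiffAt ℝ 1 F x := hF.contDiffAt (hU.mem_nhds hx)
  have hd : HasFDerivAt F
      ((fderiv ℝ F x).toContinuousLinearEquivOfDetNeZero (hdet x hx) : E →L[ℝ] E) x := by
    rw [ContinuousLinearMap.coe_toContinuousLinearEquivOfDetNeZero]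
    exact (hc.differentiableAt one_ne_zero).hasFDerivAt
  exact ⟨hc.toOpenPartialHomeomorph F hd one_ne_zero,
    hc.mem_toOpenPartialHomeomorph_source hd one_ne_zero, rfl⟩

/-- A map of a compact set `V` which is a local homeomorphism on the connected interior of `V` and
maps it to a simply connected set, and the frontier of `V` to the complement of that set, is
injective on the interior of `V`. -/
theorem injOn_interior_of_isLocalHomeomorphOn {X Y : Type*} [TopologicalSpace X] [T2Space X]
    [TopologicalSpace Y] [LocallyPathConnectedSpace Y] [T2Space Y] [FirstCountableTopology Y]
    {V : Set X} {O : Set Y} {F : X → Y} (hV : IsCompact V) (hVc : IsPreconnected (interior V))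
    (hO : IsOpen O) (hOc : IsSimplyConnected O) (hF : ContinuousOn F V)
    (hloc : IsLocalHomeomorphOn F (interior V)) (hint : MapsTo F (interior V) O)
    (hfr : MapsTo F (frontier V) Oᶜ) : InjOn F (interior V) := by
  have : PreconnectedSpace (interior V) := isPreconnected_iff_preconnectedSpace.1 hVc
  have : SimplyConnectedSpace O := hOc.simplyConnectedSpace
  have : LocallyPathConnectedSpace O := hO.locallyPathConnectedSpace
  set f : interior V → O := hint.restrict F (interior V) O
  have hfcont : Continuous f := (hF.mono interior_subset).mapsToRestrict hint
  have hf : IsLocalHomeomorph f := by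
    refine .of_comp (g := Subtype.val) ?_ hO.isOpenEmbedding_subtypeVal.isLocalHomeomorph hfcont
    change IsLocalHomeomorph (F ∘ ((↑) : interior V → X))
    exact isLocalHomeomorph_iff_isLocalHomeomorphOn_univ.2 <| hloc.comp
      isOpen_interior.isOpenEmbedding_subtypeVal.isLocalHomeomorph.isLocalHomeomorphOn
      fun x _ => x.2
  have hp : IsProperMap f := by
    refine isProperMap_iff_isCompact_preimage.2 ⟨hfcont, fun K hK => ?_⟩
    -- No frontier point of `V` maps into `K ⊆ O`, so the preimage of `K` taken in all of `V` is
    -- already in the interior; it is closed in the compact set `V`.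
    have himage : Subtype.val '' (f ⁻¹' K) = V ∩ F ⁻¹' (Subtype.val '' K) := by
      ext x
      constructor
      · rintro ⟨x, hx, rfl⟩
        exact ⟨interior_subset x.2, f x, hx, rfl⟩
      · rintro ⟨hxV, y, hyK, hy⟩
        have hx : x ∈ interior V := by
          by_contra hx
          exact hfr ⟨subset_closure hxV, hx⟩ (hy ▸ y.2)
        refine ⟨⟨x, hx⟩, ?_, rfl⟩
        have : f ⟨x, hx⟩ = y := Subtype.ext hy.symm
        rwa [mem_preimage, this]
    rw [Subtype.isCompact_iff, himage]
    exact hV.of_isClosed_subset (hF.preimage_isClosed_of_isClosed hV.isClosed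
      (hK.image continuous_subtype_val).isClosed) inter_subset_left
  have hinj := (hf.isCoveringMap_of_isProperMap hp).injective_of_simplyConnectedSpace
  exact fun x hx y hy hxy => congrArg Subtype.val (@hinj ⟨x, hx⟩ ⟨y, hy⟩ (Subtype.ext hxy))

theorem theorem5 (V W : Set Plane)
    (hV : IsClosedSimplyConnectedDomain V) (hW : IsClosedSimplyConnectedDomain W)
    (F : Plane → Plane) (hFVW : MapsTo F V W)
    (hharm : IsHarmonicMap F V)
    (hC1 : ContDiffOn ℝ 1 F (interior V)) (hC0 : ContinuousOn F V)
    (hbdry : RestrictsToHomeomorph F (frontier V) (frontier W))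
    (horient : PreservesBoundaryOrientation F V W)
    (hjac : ∀ x ∈ interior V, (fderiv ℝ F x).det ≠ 0) :
    InjOn F V := by
  obtain ⟨e, he⟩ := hbdry
  have hfr : MapsTo F (frontier V) (frontier W) := fun x hx => he ⟨x, hx⟩ ▸ (e ⟨x, hx⟩).2
  have hfrinj : InjOn F (frontier V) := fun x hx y hy hxy => by
    have : e ⟨x, hx⟩ = e ⟨y, hy⟩ := Subtype.ext (by rw [he, he]; exact hxy)
    exact congrArg Subtype.val (e.injective this)
  have hloc : IsLocalHomeomorphOn F (interior V) :=
    hC1.isLocalHomeomorphOn_of_det_fderiv_ne_zero isOpen_interior hjac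
  have hint : MapsTo F (interior V) (interior W) := fun x hx => by
    -- Openness of `F` at `x` makes `F '' V ⊆ W` a neighbourhood of `F x`.
    rw [mem_interior_iff_mem_nhds, ← hloc.map_nhds_eq hx]
    exact Filter.mem_map.2 (Filter.mem_of_superset (mem_interior_iff_mem_nhds.1 hx) hFVW)
  have hinj : InjOn F (interior V) :=
    injOn_interior_of_isLocalHomeomorphOn hV.isCompact
      hV.isSimplyConnected_interior.isPathConnected.isConnected.isPreconnected isOpen_interior
      hW.isSimplyConnected_interior hC0 hloc hint fun x hx => (hfr hx).2
  have hVeq : V = interior V ∪ frontier V := by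
    rw [← closure_eq_interior_union_frontier, hV.isCompact.isClosed.closure_eq]
  rw [hVeq, injOn_union disjoint_interior_frontier]
  exact ⟨hinj, hfrinj, fun x hx y hy hxy => (hfr hy).2 (hxy ▸ hint hx)⟩
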